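/- **Setting.** Let $\mathcal X=\mathcal X_1\times\dots\times\mathcal X_d$ be finite and let $f$ be a probability mass function on $\mathcal X$. Write $f(x_i\mid x_{-i})$ for the full conditionals of $f$. For every $i$ and $x_{-i}$ let $g(\cdot\mid x_{-i})$ be a probability mass function on $\mathcal X_i$ that is absolutely continuous with respect to $f(\cdot\mid x_{-i})$ (wherever the latter is defined). Put $$p_i(x)=\frac{g(x_i\mid x_{-i})}{f(x_i\mid x_{-i})},\qquad Z(x)=\frac1d\sum_{i=1}^d p_i(x),\qquad w(x)=\frac1{Z(x)},$$ for $x$ in the set of points with $f(x)>0$, which is taken as the state space (it is all of $\mathcal X$ if $f>0$). Consider the Markov chain $x^{(1)},x^{(2)},\dots$ with transition matrix $P_{TGS}$, in either of the following two versions. (A) Tempered Gibbs Sampler: from $x$, select $i\in\{1,\dots,d\}$ with probability proportional to $p_i(x)$, and redraw $x_i\sim g(\cdot\mid x_{-i})$. Here it is assumed that the state space has at least two points, that $Z>0$ on it, and that $P_{TGS}$ is irreducible on it. (B) Flip version on $\mathcal X=\{0,1\}^d$, $d\ge 1$, with $f>0$ and $g(\cdot\mid x_{-i})$ uniform on $\{0,1\}$: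 from $x$, select $i$ with probability proportional to $p_i(x)=1/(2f(x_i\mid x_{-i}))$, and replace $x_i$ by $1-x_i$. Define the jump matrix $Q_{TGS}(\gamma,\gamma')=Z(\gamma)P_{TGS}(\gamma,\gamma')$ for $\gamma'\ne\gamma$ and $Q_{TGS}(\gamma,\gamma)=-\sum_{\gamma'\neq\gamma}Q_{TGS}(\gamma,\gamma')$. **Claim.** In both versions $-Q_{TGS}$ has a smallest non-zero real eigenvalue $\mathrm{Gap}(Q_{TGS})$, and it is positive. For every $h:\mathcal X\to\mathbb R$ the limit $$\mathrm{var}(h,TGS)=\lim_{n\to\infty} n\,\mathrm{var}\left(\frac{\sum_{t=1}^n w(x^{(t)})h(x^{(t)})}{\sum_{t=1}^n w(x^{(t)})}\right)$$ exists, is finite and is the same for every initial distribution of the chain, and $$\mathrm{var}(h,TGS)\le\frac{2\,\mathrm{var}_f(h)}{\mathrm{Gap}(Q_{TGS})},\qquad \mathrm{var}_f(h)=\mathbb E_f[h^2]-\mathbb E_f[h]^2 .$$ -/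

import Mathlib

open Filter Topology

noncomputable section

/-! ### Finite Markov chains, self-normalised weighted estimators, jump matrices -/

/-- Probability that the Markov chain with initial distribution `μ` and transition matrix `P`
starts with the path `x 0, …, x n` (these are `n + 1` states). -/
def pathProb {S : Type*} (μ : S → ℝ) (P : Matrix S S ℝ) (n : ℕ) (x : Fin (n + 1) → S) : ℝ :=
  μ (x 0) * ∏ t : Fin n, P (x t.castSucc) (x t.succ)

/-- Expectation of a function of the first `n + 1` states of the chain. -/
def pathExp {S : Type*} [Fintype S] (μ : S → ℝ) (P : Matrix S S ℝ) (n : ℕ)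
    (F : (Fin (n + 1) → S) → ℝ) : ℝ :=
  ∑ x : Fin (n + 1) → S, pathProb μ P n x * F x

/-- Variance of a function of the first `n + 1` states of the chain. -/
def pathVar {S : Type*} [Fintype S] (μ : S → ℝ) (P : Matrix S S ℝ) (n : ℕ)
    (F : (Fin (n + 1) → S) → ℝ) : ℝ :=
  pathExp μ P n (fun x => (F x - pathExp μ P n F) ^ 2)

/-- The self-normalised weighted estimator `(∑ₜ w(xₜ) h(xₜ)) / ∑ₜ w(xₜ)` computed from the
`n + 1` states `x 0, …, x n`. -/
def weightedEstimator {S : Type*} (w h : S → ℝ) (n : ℕ) (x : Fin (n + 1) → S) : ℝ :=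
  (∑ t, w (x t) * h (x t)) / ∑ t, w (x t)

/-- `v` is the limit, as the number `N = n + 1` of samples tends to infinity, of `N` times the
variance of the weighted estimator based on the first `N` states of the chain with transition
matrix `P`, whatever the initial distribution. -/
def HasAsymptoticVariance {S : Type*} [Fintype S] (P : Matrix S S ℝ) (w h : S → ℝ) (v : ℝ) :
    Prop :=
  ∀ μ ∈ stdSimplex ℝ S,
    Tendsto (fun n : ℕ => ((n : ℝ) + 1) * pathVar μ P n (weightedEstimator w h n)) atTop (𝓝 v)

/-- The jump matrix with off-diagonal rates `Z x * P x y` and rows that sum to zero. -/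
def jumpMatrix {S : Type*} [Fintype S] [DecidableEq S] (Z : S → ℝ) (P : Matrix S S ℝ) :
    Matrix S S ℝ :=
  fun x y => if x = y then -∑ y' ∈ Finset.univ.erase x, Z x * P x y' else Z x * P x y

/-- The set of non-zero (real) eigenvalues of `-Q`. -/
def nonzeroEigenvaluesNeg {S : Type*} [Fintype S] [DecidableEq S] (Q : Matrix S S ℝ) : Set ℝ :=
  {c | c ≠ 0 ∧ Module.End.HasEigenvalue (Matrix.toLin' (-Q)) c}

/-- Mean under the probability mass function `f`. -/
def pmfMean {X : Type*} [Fintype X] (f h : X → ℝ) : ℝ := ∑ x, h x * f x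

/-- Variance under the probability mass function `f`. -/
def pmfVar {X : Type*} [Fintype X] (f h : X → ℝ) : ℝ :=
  pmfMean f (fun x => h x ^ 2) - pmfMean f h ^ 2

/-! ### The tempered Gibbs sampler on a finite product space -/

/-- The vector `x_{-i}` of all coordinates of `x` other than the `i`-th. -/
def dropCoord {d : ℕ} {α : Fin d → Type*} (i : Fin d) (x : ∀ j, α j) :
    ∀ j : {j : Fin d // j ≠ i}, α j.1 :=
  fun j => x j.1

/-- The marginal `f(x_{-i})`. -/
def marginalDrop {d : ℕ} {α : Fin d → Type*} [∀ i, Fintype (α i)]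
    (f : (∀ i, α i) → ℝ) (i : Fin d) (x : ∀ j, α j) : ℝ :=
  ∑ a : α i, f (Function.update x i a)

/-- The full conditional `f(x_i | x_{-i})`. -/
def fullCond {d : ℕ} {α : Fin d → Type*} [∀ i, Fintype (α i)]
    (f : (∀ i, α i) → ℝ) (i : Fin d) (x : ∀ j, α j) : ℝ :=
  f x / marginalDrop f i x

/-- `g i z a` stands for `g(x_i = a | x_{-i} = z)`: for all `i` and `z` it is a probability mass
function, absolutely continuous with respect to the full conditional of `f` (wherever the latter
is defined). -/
structure IsModifiedConditionals {d : ℕ} {α : Fin d → Type*} [∀ i, Fintype (α i)]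
    (f : (∀ i, α i) → ℝ)
    (g : ∀ i : Fin d, (∀ j : {j : Fin d // j ≠ i}, α j.1) → α i → ℝ) : Prop where
  prob : ∀ i z, g i z ∈ stdSimplex ℝ (α i)
  absCont : ∀ i x, 0 < marginalDrop f i x → fullCond f i x = 0 → g i (dropCoord i x) (x i) = 0

/-- `p_i(x) = g(x_i | x_{-i}) / f(x_i | x_{-i})`. -/
def condRatio {d : ℕ} {α : Fin d → Type*} [∀ i, Fintype (α i)] (f : (∀ i, α i) → ℝ)
    (g : ∀ i : Fin d, (∀ j : {j : Fin d // j ≠ i}, α j.1) → α i → ℝ)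
    (i : Fin d) (x : ∀ j, α j) : ℝ :=
  g i (dropCoord i x) (x i) / fullCond f i x

/-- `Z(x) = (1/d) ∑ᵢ p_i(x)`. -/
def tgsZ {d : ℕ} {α : Fin d → Type*} [∀ i, Fintype (α i)] (f : (∀ i, α i) → ℝ)
    (g : ∀ i : Fin d, (∀ j : {j : Fin d // j ≠ i}, α j.1) → α i → ℝ) (x : ∀ j, α j) : ℝ :=
  1 / (d : ℝ) * ∑ i, condRatio f g i x

/-- Probability of selecting coordinate `i` at state `x`: proportional to `p_i(x)`. -/
def selectProb {d : ℕ} {α : Fin d → Type*} [∀ i, Fintype (α i)] (f : (∀ i, α i) → ℝ)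
    (g : ∀ i : Fin d, (∀ j : {j : Fin d // j ≠ i}, α j.1) → α i → ℝ)
    (i : Fin d) (x : ∀ j, α j) : ℝ :=
  condRatio f g i x / ∑ j, condRatio f g j x

/-- The state space on which the conditionals, the `p_i` and `Z` are defined: the points of
positive `f`-probability (all points if `f > 0`). -/
abbrev Supp {X : Type*} (f : X → ℝ) : Type _ := {x : X // 0 < f x}

/-- Transition matrix of the tempered Gibbs sampler: select `i` proportionally to `p_i(x)`, then
redraw `x_i` from `g(· | x_{-i})`. -/
def tgsKernel {d : ℕ} {α : Fin d → Type*} [∀ i, Fintype (α i)] [∀ i, DecidableEq (α i)]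
    (f : (∀ i, α i) → ℝ)
    (g : ∀ i : Fin d, (∀ j : {j : Fin d // j ≠ i}, α j.1) → α i → ℝ) :
    Matrix (Supp f) (Supp f) ℝ :=
  fun x y => ∑ i, selectProb f g i x.1 *
    (if dropCoord i y.1 = dropCoord i x.1 then g i (dropCoord i x.1) (y.1 i) else 0)

/-! ### The version for binary vectors, with deterministic flips -/

/-- The uniform modified conditionals on `{0,1}`. -/
def unifCond {p : ℕ} : ∀ i : Fin p, ({j : Fin p // j ≠ i} → Bool) → Bool → ℝ :=
  fun _ _ _ => 1 / 2

/-- Transition matrix of the sampler on `{0,1}^p` that selects `i` proportionally to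
`p_i(γ) = 1 / (2 f(γ_i | γ_{-i}))` and then flips `γ_i`. -/
def flipKernel {p : ℕ} (f : (Fin p → Bool) → ℝ) :
    Matrix (Fin p → Bool) (Fin p → Bool) ℝ :=
  fun x y => ∑ i, selectProb f unifCond i x *
    (if y = Function.update x i (!x i) then 1 else 0)

end

/-!
The tempered Gibbs sampler and its flip version are reversible with respect to `π = f * Z`, which
is a probability because every `f * p_i` sums to one. Both are therefore instances of one abstract
situation, `IsReversibleJumpChain`: a finite irreducible chain `P` that satisfies detailed balance
for `f * Z`, so that `-Q = Z (1 - P)` is self-adjoint and positive in `L²(f)`, with the constants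
as its kernel.

*Asymptotic variance.* Irreducibility makes the Poisson equation `φ = π(φ) + u - P u` solvable for
every `φ` (`exists_poisson_solution`), whether or not the chain is periodic. The additive functional
of `u - P u` is a martingale up to a bounded boundary term, so its mean is bounded, its fourth moment
is `O(n²)`, and its second moment is `n * π(stepVar P u) + O(√n)`; the limit of the Cesàro means of
`stepVar P u` comes from a second Poisson equation (`exists_additive_moment_bounds`). The weighted
estimator is `m + A / B`, where `m = E_f h`, `A` is the additive functional of `w * (h - m)` and `B`
that of `w`, and `π(w) = 1`. The moment bounds justify the replacement of `B` by `n` in the first two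
moments of `A / B` (`hasAsymptoticVariance_of_poisson`); they hold for every initial distribution,
with a limit that does not depend on it.

*Bound.* If `u` solves the Poisson equation for `w * (h - m)`, then `-Q u = h - m`. The limit
`π(u²) - π((P u)²)` is at most `2 π(u (u - P u)) = 2 ⟨u, h - m⟩` in `L²(f)`, and the spectral theorem
for the symmetrised matrix of `-Q` gives `gap * ⟨u, -Q u⟩ ≤ ‖Q u‖² = var_f(h)`.
-/

noncomputable section

/-! ### Expectations over paths of a finite Markov chain -/

section PathExpectation

variable {S : Type*} [Fintype S] {μ : S → ℝ} {P : Matrix S S ℝ} {n : ℕ}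

theorem pathExp_zero (F : (Fin 1 → S) → ℝ) :
    pathExp μ P 0 F = ∑ s, μ s * F (fun _ => s) := by
  unfold pathExp pathProb
  rw [← (Equiv.funUnique (Fin 1) S).symm.sum_comp]
  refine Finset.sum_congr rfl fun s _ => ?_
  have : (Equiv.funUnique (Fin 1) S).symm s = fun _ => s := rfl
  simp [this]

/-- The Markov property: averaging over the last step of the chain first. -/
theorem pathExp_succ (F : (Fin (n + 2) → S) → ℝ) :
    pathExp μ P (n + 1) F =
      pathExp μ P n (fun x => ∑ y, P (x (Fin.last n)) y * F (Fin.snoc x y)) := by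
  unfold pathExp pathProb
  rw [← (Fin.snocEquiv (fun _ : Fin (n + 2) => S)).sum_comp, Fintype.sum_prod_type_right]
  refine Finset.sum_congr rfl fun x _ => ?_
  rw [Finset.mul_sum]
  refine Finset.sum_congr rfl fun y _ => ?_
  simp only [Fin.snocEquiv, Equiv.coe_fn_mk]
  rw [Fin.prod_univ_castSucc]
  have h0 : (Fin.snoc x y : Fin (n + 2) → S) 0 = x 0 := Fin.snoc_castSucc (α := fun _ => S) y x 0
  have hs : ∀ t : Fin (n + 1), (Fin.snoc x y : Fin (n + 2) → S) t.castSucc = x t := fun t =>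
    Fin.snoc_castSucc (α := fun _ => S) y x t
  have hl : (Fin.snoc x y : Fin (n + 2) → S) (Fin.last n).succ = y :=
    Fin.snoc_last (α := fun _ => S) y x
  have hs' : ∀ t : Fin n, (Fin.snoc x y : Fin (n + 2) → S) t.castSucc.succ = x t.succ := fun t => by
    rw [Fin.succ_castSucc]; exact hs _
  simp only [h0, hs, hl, hs']
  ring

theorem pathExp_add (F G : (Fin (n + 1) → S) → ℝ) :
    pathExp μ P n (fun x => F x + G x) = pathExp μ P n F + pathExp μ P n G := by
  simp [pathExp, mul_add, Finset.sum_add_distrib]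

theorem pathExp_sub (F G : (Fin (n + 1) → S) → ℝ) :
    pathExp μ P n (fun x => F x - G x) = pathExp μ P n F - pathExp μ P n G := by
  simp [pathExp, mul_sub, Finset.sum_sub_distrib]

theorem pathExp_const_mul (c : ℝ) (F : (Fin (n + 1) → S) → ℝ) :
    pathExp μ P n (fun x => c * F x) = c * pathExp μ P n F := by
  simp only [pathExp, Finset.mul_sum]
  exact Finset.sum_congr rfl fun x _ => by ring

theorem pathExp_const (hμ : ∑ s, μ s = 1) (hP1 : ∀ x, ∑ y, P x y = 1) (c : ℝ) :
    pathExp μ P n (fun _ => c) = c := by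
  induction n with
  | zero => rw [pathExp_zero, ← Finset.sum_mul, hμ, one_mul]
  | succ n ih => rw [pathExp_succ]; simpa [← Finset.sum_mul, hP1] using ih

theorem pathExp_mono (hμ : ∀ s, 0 ≤ μ s) (hP : ∀ x y, 0 ≤ P x y) {F G : (Fin (n + 1) → S) → ℝ}
    (h : ∀ x, F x ≤ G x) : pathExp μ P n F ≤ pathExp μ P n G :=
  Finset.sum_le_sum fun x _ => mul_le_mul_of_nonneg_left (h x)
    (mul_nonneg (hμ _) (Finset.prod_nonneg fun _ _ => hP _ _))

theorem abs_pathExp_le (hμ : ∀ s, 0 ≤ μ s) (hP : ∀ x y, 0 ≤ P x y)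
    {F G : (Fin (n + 1) → S) → ℝ} (h : ∀ x, |F x| ≤ G x) :
    |pathExp μ P n F| ≤ pathExp μ P n G := by
  refine abs_le.2 ⟨?_, pathExp_mono hμ hP fun x => (le_abs_self _).trans (h x)⟩
  have := pathExp_mono hμ hP (n := n) (F := fun x => -1 * F x) (G := G)
    fun x => by linarith [(neg_le_abs (F x)).trans (h x)]
  rw [pathExp_const_mul] at this
  linarith

theorem pathExp_succ_last (k : S → ℝ) :
    pathExp μ P (n + 1) (fun x => k (x (Fin.last (n + 1)))) =
      pathExp μ P n (fun x => (P.mulVec k) (x (Fin.last n))) := by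
  rw [pathExp_succ]
  simp only [Fin.snoc_last]
  rfl

/-- The variance of the path functional is its second moment minus the square of its mean, and it
does not change when a constant is added. -/
theorem pathVar_const_add (hμ : ∑ s, μ s = 1) (hP1 : ∀ x, ∑ y, P x y = 1) (m : ℝ)
    (F : (Fin (n + 1) → S) → ℝ) :
    pathVar μ P n (fun x => m + F x) = pathExp μ P n (fun x => F x ^ 2) - pathExp μ P n F ^ 2 := by
  unfold pathVar
  rw [pathExp_add, pathExp_const hμ hP1]
  have : ∀ x, (m + F x - (m + pathExp μ P n F)) ^ 2 =
      F x ^ 2 - 2 * pathExp μ P n F * F x + pathExp μ P n F ^ 2 := fun x => by ring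
  simp only [this]
  rw [pathExp_add, pathExp_sub, pathExp_const_mul, pathExp_const hμ hP1]
  ring

end PathExpectation

/-! ### Poisson equation and moments of additive functionals -/

section Poisson

variable {S : Type*} [Fintype S] {P : Matrix S S ℝ}

theorem sum_mul_mulVec {w : S → ℝ} (hw : ∀ y, ∑ x, w x * P x y = w y) (u : S → ℝ) :
    ∑ x, w x * P.mulVec u x = ∑ x, w x * u x := by
  simp only [Matrix.mulVec, dotProduct, Finset.mul_sum]
  rw [Finset.sum_comm]
  refine Finset.sum_congr rfl fun y _ => ?_
  rw [← hw y, Finset.sum_mul]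
  exact Finset.sum_congr rfl fun x _ => by ring

/-- Solvability of the Poisson equation. The map `u ↦ u - P u + w(u)` is injective when harmonic
functions are constant, hence surjective, and applying `w` shows that the solution of
`u - P u + w(u) = φ` has `w(u) = w(φ)`. -/
theorem exists_poisson_solution {w : S → ℝ} (hw1 : ∑ x, w x = 1)
    (hw : ∀ y, ∑ x, w x * P x y = w y)
    (hharm : ∀ u : S → ℝ, P.mulVec u = u → ∀ x y, u x = u y) (φ : S → ℝ) :
    ∃ u : S → ℝ, ∀ x, φ x = (∑ y, w y * φ y) + (u x - P.mulVec u x) := by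
  let T : (S → ℝ) →ₗ[ℝ] (S → ℝ) :=
    { toFun := fun u x => u x - P.mulVec u x + ∑ y, w y * u y
      map_add' := fun u v => by
        ext x
        simp only [Matrix.mulVec_add, Pi.add_apply, mul_add, Finset.sum_add_distrib]
        ring
      map_smul' := fun c u => by
        ext x
        simp only [Matrix.mulVec_smul, Pi.smul_apply, smul_eq_mul, RingHom.id_apply, mul_add,
          Finset.mul_sum, mul_sub]
        congr 1
        exact Finset.sum_congr rfl fun y _ => by ring }
  have hT : ∀ u x, T u x = u x - P.mulVec u x + ∑ y, w y * u y := fun _ _ => rfl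
  have hmean : ∀ u, ∑ x, w x * T u x = ∑ x, w x * u x := fun u => by
    simp only [hT, mul_add, mul_sub, Finset.sum_add_distrib, Finset.sum_sub_distrib,
      ← Finset.sum_mul, hw1, sum_mul_mulVec hw]
    ring
  have hinj : Function.Injective T := by
    refine (injective_iff_map_eq_zero T).2 fun u hu => ?_
    have h0 : ∑ x, w x * u x = 0 := by rw [← hmean, hu]; simp
    have hPu : P.mulVec u = u := by
      ext x
      have := congrFun hu x
      rw [hT, h0] at this
      simp only [Pi.zero_apply] at this
      linarith
    ext x
    have : ∑ y, w y * u y = u x := by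
      rw [Finset.sum_congr rfl fun y _ => by rw [hharm u hPu y x], ← Finset.sum_mul, hw1, one_mul]
    rw [← this, h0]; rfl
  obtain ⟨u, hu⟩ := LinearMap.injective_iff_surjective.1 hinj φ
  refine ⟨u, fun x => ?_⟩
  rw [← hu, hmean, hT]; ring

/-- The martingale attached to a solution `u` of a Poisson equation: the additive functional of
`u - P u` plus the boundary term `P u`. -/
def poissonMartingale (P : Matrix S S ℝ) (u : S → ℝ) (n : ℕ) (x : Fin (n + 1) → S) : ℝ :=
  ∑ t, (u (x t) - P.mulVec u (x t)) + P.mulVec u (x (Fin.last n))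

/-- The conditional variance of `u` after one step of the chain. -/
def stepVar (P : Matrix S S ℝ) (u : S → ℝ) (x : S) : ℝ :=
  ∑ y, P x y * (u y - P.mulVec u x) ^ 2

theorem poissonMartingale_snoc (u : S → ℝ) (n : ℕ) (x : Fin (n + 1) → S) (y : S) :
    poissonMartingale P u (n + 1) (Fin.snoc x y) =
      poissonMartingale P u n x + (u y - P.mulVec u (x (Fin.last n))) := by
  unfold poissonMartingale
  rw [Fin.sum_univ_castSucc]
  simp only [Fin.snoc_castSucc, Fin.snoc_last]
  ring

theorem poissonMartingale_zero (u : S → ℝ) (s : S) :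
    poissonMartingale P u 0 (fun _ => s) = u s := by
  simp [poissonMartingale]

variable (hP1 : ∀ x, ∑ y, P x y = 1)
include hP1

theorem sum_mul_sub_mulVec (u : S → ℝ) (x : S) : ∑ y, P x y * (u y - P.mulVec u x) = 0 := by
  simp only [mul_sub, Finset.sum_sub_distrib, ← Finset.sum_mul, hP1]
  simp [Matrix.mulVec, dotProduct]

variable {μ : S → ℝ} {n : ℕ}

theorem pathExp_poissonMartingale (u : S → ℝ) :
    pathExp μ P n (poissonMartingale P u n) = ∑ s, μ s * u s := by
  induction n with
  | zero => simp [pathExp_zero, poissonMartingale_zero]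
  | succ n ih =>
    rw [pathExp_succ, ← ih]
    congr 1; ext x
    simp only [poissonMartingale_snoc, mul_add, Finset.sum_add_distrib, ← Finset.sum_mul, hP1,
      sum_mul_sub_mulVec hP1, one_mul, add_zero]

theorem pathExp_succ_poissonMartingale_sq (u : S → ℝ) :
    pathExp μ P (n + 1) (fun x => poissonMartingale P u (n + 1) x ^ 2) =
      pathExp μ P n (fun x => poissonMartingale P u n x ^ 2) +
        pathExp μ P n (fun x => stepVar P u (x (Fin.last n))) := by
  rw [pathExp_succ, ← pathExp_add]
  congr 1; ext x
  simp only [poissonMartingale_snoc]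
  set M := poissonMartingale P u n x
  set z := x (Fin.last n)
  have : ∀ y, P z y * (M + (u y - P.mulVec u z)) ^ 2 =
      P z y * M ^ 2 + 2 * M * (P z y * (u y - P.mulVec u z)) +
        P z y * (u y - P.mulVec u z) ^ 2 := fun y => by ring
  simp only [this, Finset.sum_add_distrib, ← Finset.mul_sum, ← Finset.sum_mul, hP1,
    sum_mul_sub_mulVec hP1, stepVar]
  ring

/-- When `k` solves the Poisson equation for the conditional variance, the second moment of the
martingale is linear in time up to a bounded boundary term. -/
theorem pathExp_poissonMartingale_sq {u k : S → ℝ} {c : ℝ} (hμ : ∑ s, μ s = 1)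
    (hk : ∀ x, stepVar P u x = c + (k x - P.mulVec k x)) :
    pathExp μ P n (fun x => poissonMartingale P u n x ^ 2) +
        pathExp μ P n (fun x => k (x (Fin.last n))) =
      n * c + ((∑ s, μ s * u s ^ 2) + ∑ s, μ s * k s) := by
  induction n with
  | zero => simp [pathExp_zero, poissonMartingale_zero]
  | succ n ih =>
    rw [pathExp_succ_poissonMartingale_sq hP1, pathExp_succ_last]
    simp only [hk]
    rw [pathExp_add, pathExp_sub, pathExp_const hμ hP1]
    push_cast
    linarith

/-- One-step recursion for the fourth moment. Its increments are bounded by a multiple of the second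
moment, which grows linearly, so the fourth moment grows quadratically. -/
theorem pathExp_succ_poissonMartingale_pow_four_le {u : S → ℝ} {K : ℝ} (hμ : ∀ s, 0 ≤ μ s)
    (hμ1 : ∑ s, μ s = 1) (hP : ∀ x y, 0 ≤ P x y) (hK : ∀ x y, |u y - P.mulVec u x| ≤ K) :
    pathExp μ P (n + 1) (fun x => poissonMartingale P u (n + 1) x ^ 4) ≤
      pathExp μ P n (fun x => poissonMartingale P u n x ^ 4) +
        (8 * K ^ 2 * pathExp μ P n (fun x => poissonMartingale P u n x ^ 2) + 3 * K ^ 4) := by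
  rw [pathExp_succ, ← pathExp_const hμ1 hP1 (n := n) (3 * K ^ 4), ← pathExp_const_mul,
    ← pathExp_add, ← pathExp_add]
  refine pathExp_mono hμ hP fun x => ?_
  simp only [poissonMartingale_snoc]
  set M := poissonMartingale P u n x
  set z := x (Fin.last n)
  have key : ∀ y, P z y * (M + (u y - P.mulVec u z)) ^ 4 ≤
      P z y * (M ^ 4 + (8 * K ^ 2 * M ^ 2 + 3 * K ^ 4)) +
        4 * M ^ 3 * (P z y * (u y - P.mulVec u z)) := fun y => by
    have hD := sq_le_sq' (abs_le.1 (hK z y)).1 (abs_le.1 (hK z y)).2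
    set D := u y - P.mulVec u z
    -- expand, and split the cubic term by `2 * (M * D) * D ^ 2 ≤ (M * D) ^ 2 + D ^ 4`
    have h1 : (M + D) ^ 4 ≤ M ^ 4 + (8 * K ^ 2 * M ^ 2 + 3 * K ^ 4) + 4 * M ^ 3 * D := by
      have e1 : M ^ 2 * D ^ 2 ≤ M ^ 2 * K ^ 2 := mul_le_mul_of_nonneg_left hD (sq_nonneg _)
      have e2 : D ^ 2 * D ^ 2 ≤ K ^ 2 * K ^ 2 := mul_le_mul hD hD (sq_nonneg _) (sq_nonneg _)
      nlinarith [sq_nonneg (M * D - D ^ 2)]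
    calc _ ≤ P z y * (M ^ 4 + (8 * K ^ 2 * M ^ 2 + 3 * K ^ 4) + 4 * M ^ 3 * D) :=
          mul_le_mul_of_nonneg_left h1 (hP _ _)
      _ = _ := by ring
  refine (Finset.sum_le_sum fun y _ => key y).trans (le_of_eq ?_)
  simp only [Finset.sum_add_distrib, ← Finset.mul_sum, ← Finset.sum_mul, hP1,
    sum_mul_sub_mulVec hP1]
  ring

omit hP1 in
theorem exists_abs_le_of_fintype (k : S → ℝ) : ∃ K, 0 ≤ K ∧ ∀ x, |k x| ≤ K :=
  ⟨∑ x, |k x|, Finset.sum_nonneg fun _ _ => abs_nonneg _, fun x =>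
    Finset.single_le_sum (f := fun x => |k x|) (fun _ _ => abs_nonneg _) (Finset.mem_univ x)⟩

end Poisson

section Moments

variable {S : Type*} [Fintype S] {P : Matrix S S ℝ} {w μ : S → ℝ}

theorem exists_poissonMartingale_moment_bounds (hP : ∀ x y, 0 ≤ P x y)
    (hP1 : ∀ x, ∑ y, P x y = 1) (hw1 : ∑ x, w x = 1) (hw : ∀ y, ∑ x, w x * P x y = w y)
    (hharm : ∀ u : S → ℝ, P.mulVec u = u → ∀ x y, u x = u y)
    (hμ : μ ∈ stdSimplex ℝ S) (u : S → ℝ) :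
    ∃ C, 0 ≤ C ∧ ∀ n : ℕ,
      |pathExp μ P n (fun x => poissonMartingale P u n x ^ 2) -
        (n + 1) * ∑ x, w x * stepVar P u x| ≤ C ∧
      pathExp μ P n (fun x => poissonMartingale P u n x ^ 2) ≤ C * (n + 1) ∧
      pathExp μ P n (fun x => poissonMartingale P u n x ^ 4) ≤ C * (n + 1) ^ 2 := by
  obtain ⟨hμ0, hμ1⟩ := hμ
  set c := ∑ x, w x * stepVar P u x
  obtain ⟨k, hk⟩ := exists_poisson_solution hw1 hw hharm (stepVar P u)
  obtain ⟨Kk, hKk0, hKk⟩ := exists_abs_le_of_fintype k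
  obtain ⟨K, hK0, hK⟩ := exists_abs_le_of_fintype (fun p : S × S => u p.2 - P.mulVec u p.1)
  set a := (∑ s, μ s * u s ^ 2) + ∑ s, μ s * k s
  set C₁ := |a| + Kk + |c| with hC₁
  have hC₁0 : 0 ≤ C₁ := by positivity
  have h1 : ∀ n : ℕ, |pathExp μ P n (fun x => poissonMartingale P u n x ^ 2) -
      (n + 1) * c| ≤ C₁ := fun n => by
    have e := pathExp_poissonMartingale_sq hP1 (n := n) hμ1 hk
    have b := abs_pathExp_le hμ0 hP (n := n) (F := fun x => k (x (Fin.last n)))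
      (G := fun _ => Kk) fun x => hKk _
    rw [pathExp_const hμ1 hP1] at b
    have : pathExp μ P n (fun x => poissonMartingale P u n x ^ 2) - (n + 1) * c =
        a - pathExp μ P n (fun x => k (x (Fin.last n))) - c := by linarith
    rw [this]
    have t1 := abs_sub (a - pathExp μ P n (fun x => k (x (Fin.last n)))) c
    have t2 := abs_sub a (pathExp μ P n (fun x => k (x (Fin.last n))))
    linarith
  set C₂ := C₁ + |c|
  have hC₂0 : 0 ≤ C₂ := by positivity
  have h2 : ∀ n : ℕ, pathExp μ P n (fun x => poissonMartingale P u n x ^ 2) ≤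
      C₂ * (n + 1) := fun n => by
    have hn : (0 : ℝ) ≤ n := n.cast_nonneg
    have := (abs_le.1 (h1 n)).2
    nlinarith [le_abs_self c, abs_nonneg c]
  set a₄ := ∑ s, μ s * u s ^ 4
  have ha₄ : 0 ≤ a₄ := Finset.sum_nonneg fun s _ => mul_nonneg (hμ0 s) (by positivity)
  set C₃ := a₄ + (8 * K ^ 2 * C₂ + 3 * K ^ 4)
  have hb : 0 ≤ 8 * K ^ 2 * C₂ + 3 * K ^ 4 := by positivity
  have h4 : ∀ n : ℕ, pathExp μ P n (fun x => poissonMartingale P u n x ^ 4) ≤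
      C₃ * (n + 1) ^ 2 := fun n => by
    induction n with
    | zero => simp [pathExp_zero, poissonMartingale_zero, C₃, a₄]; positivity
    | succ n ih =>
      have e := pathExp_succ_poissonMartingale_pow_four_le hP1 (n := n) hμ0 hμ1 hP
        (fun x y => hK (x, y))
      have e2 := mul_le_mul_of_nonneg_left (h2 n) (by positivity : 0 ≤ 8 * K ^ 2)
      have hn : (0 : ℝ) ≤ n := n.cast_nonneg
      have e3 : 3 * K ^ 4 * 1 ≤ 3 * K ^ 4 * (n + 1) :=
        mul_le_mul_of_nonneg_left (by linarith) (by positivity)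
      have e4 : (8 * K ^ 2 * C₂ + 3 * K ^ 4) * (n + 1) ≤ C₃ * (n + 1) :=
        mul_le_mul_of_nonneg_right (by simp only [C₃]; linarith) (by positivity)
      have e5 : 0 ≤ C₃ * (n + 2) := mul_nonneg (by positivity) (by positivity)
      push_cast
      nlinarith
  have hC₃0 : 0 ≤ C₃ := by positivity
  refine ⟨C₁ + C₂ + C₃, by positivity, fun n => ⟨(h1 n).trans (by linarith), ?_, ?_⟩⟩
  · exact (h2 n).trans (mul_le_mul_of_nonneg_right (by linarith) (by positivity))
  · exact (h4 n).trans (mul_le_mul_of_nonneg_right (by linarith) (by positivity))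

/-- Moments of the additive functional of `u - P u`. It differs from the martingale by a bounded
boundary term, so its mean is bounded, its second moment grows linearly with slope the stationary
mean of `stepVar P u`, and its fourth moment grows at most quadratically. -/
theorem exists_additive_moment_bounds (hP : ∀ x y, 0 ≤ P x y)
    (hP1 : ∀ x, ∑ y, P x y = 1) (hw1 : ∑ x, w x = 1) (hw : ∀ y, ∑ x, w x * P x y = w y)
    (hharm : ∀ u : S → ℝ, P.mulVec u = u → ∀ x y, u x = u y)
    (hμ : μ ∈ stdSimplex ℝ S) {φ u : S → ℝ} (hφ : ∀ x, φ x = u x - P.mulVec u x) :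
    ∃ C, 0 ≤ C ∧ ∀ n : ℕ,
      |pathExp μ P n (fun x => ∑ t, φ (x t))| ≤ C ∧
      pathExp μ P n (fun x => (∑ t, φ (x t)) ^ 2) ≤ C * (n + 1) ∧
      pathExp μ P n (fun x => (∑ t, φ (x t)) ^ 4) ≤ C * (n + 1) ^ 2 ∧
      |pathExp μ P n (fun x => (∑ t, φ (x t)) ^ 2) - (n + 1) * ∑ x, w x * stepVar P u x| ≤
        C * √(n + 1) := by
  obtain ⟨C, hC, hM⟩ := exists_poissonMartingale_moment_bounds hP hP1 hw1 hw hharm hμ u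
  obtain ⟨hμ0, hμ1⟩ := hμ
  obtain ⟨K, hK0, hK⟩ := exists_abs_le_of_fintype (P.mulVec u)
  have hA : ∀ (n : ℕ) (x : Fin (n + 1) → S), ∑ t, φ (x t) =
      poissonMartingale P u n x - P.mulVec u (x (Fin.last n)) := fun n x => by
    simp [poissonMartingale, hφ]
  have hpt2 : ∀ (n : ℕ) (x : Fin (n + 1) → S), (∑ t, φ (x t)) ^ 2 ≤
      2 * poissonMartingale P u n x ^ 2 + 2 * K ^ 2 := fun n x => by
    rw [hA]
    have := sq_le_sq' (abs_le.1 (hK (x (Fin.last n)))).1 (abs_le.1 (hK (x (Fin.last n)))).2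
    nlinarith [sq_nonneg (poissonMartingale P u n x + P.mulVec u (x (Fin.last n)))]
  have hone : ∀ n : ℕ, (1 : ℝ) ≤ n + 1 := fun n => by
    have : (0 : ℝ) ≤ n := n.cast_nonneg
    linarith
  have g1 : ∀ n : ℕ, |pathExp μ P n (fun x => ∑ t, φ (x t))| ≤ |∑ s, μ s * u s| + K := fun n => by
    simp only [hA]
    rw [pathExp_sub, pathExp_poissonMartingale hP1]
    refine (abs_sub _ _).trans (add_le_add_right ?_ _)
    rw [← pathExp_const hμ1 hP1 (n := n) K]
    exact abs_pathExp_le hμ0 hP fun x => hK _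
  have g2 : ∀ n : ℕ, pathExp μ P n (fun x => (∑ t, φ (x t)) ^ 2) ≤
      (2 * C + 2 * K ^ 2) * (n + 1) := fun n => by
    refine (pathExp_mono hμ0 hP (hpt2 n)).trans ?_
    rw [pathExp_add, pathExp_const_mul, pathExp_const hμ1 hP1]
    nlinarith [(hM n).2.1, hone n, sq_nonneg K]
  have g4 : ∀ n : ℕ, pathExp μ P n (fun x => (∑ t, φ (x t)) ^ 4) ≤
      (8 * C + 8 * K ^ 4) * (n + 1) ^ 2 := fun n => by
    have hpt4 : ∀ x : Fin (n + 1) → S, (∑ t, φ (x t)) ^ 4 ≤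
        8 * poissonMartingale P u n x ^ 4 + 8 * K ^ 4 := fun x => by
      have h := hpt2 n x
      have h' := mul_self_le_mul_self (sq_nonneg _) h
      nlinarith [sq_nonneg (poissonMartingale P u n x ^ 2 - K ^ 2)]
    refine (pathExp_mono hμ0 hP hpt4).trans ?_
    rw [pathExp_add, pathExp_const_mul, pathExp_const hμ1 hP1]
    have h1 : (1 : ℝ) ≤ (n + 1) ^ 2 := one_le_pow₀ (hone n)
    have h2 : 0 ≤ K ^ 4 := by positivity
    nlinarith [(hM n).2.2]
  have gc : ∀ n : ℕ, |pathExp μ P n (fun x => (∑ t, φ (x t)) ^ 2) -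
      (n + 1) * ∑ x, w x * stepVar P u x| ≤ (K * (C + 1) + K ^ 2 + C) * √(n + 1) := fun n => by
    set r := √((n : ℝ) + 1)
    have hr2 : r ^ 2 = n + 1 := Real.sq_sqrt (by linarith [hone n])
    have hr1 : 1 ≤ r := Real.one_le_sqrt.2 (hone n)
    have hr0 : 0 < r := by linarith
    have hpt : ∀ x : Fin (n + 1) → S,
        |(∑ t, φ (x t)) ^ 2 - poissonMartingale P u n x ^ 2| ≤
          K / r * poissonMartingale P u n x ^ 2 + (K * r + K ^ 2) := fun x => by
      rw [hA]
      have hq := hK (x (Fin.last n))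
      set q := P.mulVec u (x (Fin.last n))
      set M := poissonMartingale P u n x
      have hamgm : 2 * |M| ≤ M ^ 2 / r + r := by
        rw [div_add' _ _ _ hr0.ne', le_div_iff₀ hr0, ← sq_abs M]
        nlinarith [sq_nonneg (|M| - r)]
      have e : (M - q) ^ 2 - M ^ 2 = -(2 * M * q) + q ^ 2 := by ring
      rw [e]
      refine (abs_add_le _ _).trans ?_
      rw [abs_neg, abs_mul, abs_mul, abs_two, abs_of_nonneg (sq_nonneg q)]
      have e1 : 2 * |M| * |q| ≤ (M ^ 2 / r + r) * K :=
        mul_le_mul hamgm hq (abs_nonneg _) (by positivity)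
      have e2 : q ^ 2 ≤ K ^ 2 := sq_le_sq' (abs_le.1 hq).1 (abs_le.1 hq).2
      have e3 : (M ^ 2 / r + r) * K = K / r * M ^ 2 + K * r := by ring
      linarith
    have hd := abs_pathExp_le hμ0 hP hpt
    rw [pathExp_sub, pathExp_add, pathExp_const_mul, pathExp_const hμ1 hP1] at hd
    have hE : K / r * pathExp μ P n (fun x => poissonMartingale P u n x ^ 2) ≤ K * C * r := by
      refine (mul_le_mul_of_nonneg_left (hM n).2.1 (by positivity)).trans (le_of_eq ?_)
      rw [← hr2]; field_simp
    have tri := abs_sub_le (pathExp μ P n (fun x => (∑ t, φ (x t)) ^ 2))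
      (pathExp μ P n (fun x => poissonMartingale P u n x ^ 2))
      ((n + 1) * ∑ x, w x * stepVar P u x)
    have := (hM n).1
    nlinarith [mul_le_mul_of_nonneg_left hr1 (sq_nonneg K), mul_le_mul_of_nonneg_left hr1 hC]
  have p1 : 0 ≤ |∑ s, μ s * u s| + K := by positivity
  have p2 : 0 ≤ 2 * C + 2 * K ^ 2 := by positivity
  have p3 : 0 ≤ 8 * C + 8 * K ^ 4 := by positivity
  have p4 : 0 ≤ K * (C + 1) + K ^ 2 + C := by positivity
  refine ⟨(|∑ s, μ s * u s| + K) + (2 * C + 2 * K ^ 2) + (8 * C + 8 * K ^ 4) +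
    (K * (C + 1) + K ^ 2 + C), by positivity, fun n => ⟨(g1 n).trans (by linarith),
    (g2 n).trans ?_, (g4 n).trans ?_, (gc n).trans ?_⟩⟩ <;>
  exact mul_le_mul_of_nonneg_right (by linarith) (by positivity)

end Moments

/-! ### The self-normalised estimator -/

section Ratio

/-- Squared ratio estimate: replacing the random normalisation `B` by its mean `N` in
`N * (A / B) ^ 2` costs a product of moments of order `√N`. -/
theorem abs_ratio_sq_sub_le {N A B w₀ : ℝ} (hN : 0 < N) (hw₀ : 0 < w₀) (hw₁ : w₀ ≤ 1)
    (hB : w₀ * N ≤ B) :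
    |N * (A / B) ^ 2 - A ^ 2 / N| ≤
      (1 / w₀ ^ 2) * ((A ^ 4 / √N + √N * (B - N) ^ 2) / N ^ 2) := by
  have hB0 : 0 < B := (mul_pos hw₀ hN).trans_le hB
  set r := √N
  have hr : 0 < r := Real.sqrt_pos.2 hN
  have e : N * (A / B) ^ 2 - A ^ 2 / N = -(A ^ 2 * (B - N) * ((N + B) / (N * B ^ 2))) := by
    field_simp; ring
  have h1 : (N + B) / (N * B ^ 2) ≤ (1 / w₀ ^ 2) * (2 / N ^ 2) := by
    rw [div_mul_div_comm, div_le_div_iff₀ (by positivity) (by positivity)]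
    have t1 : w₀ ^ 2 * N ^ 2 ≤ B ^ 2 := by
      rw [← mul_pow]; exact pow_le_pow_left₀ (by positivity) hB 2
    have t2 : w₀ ^ 2 * N * B ≤ B ^ 2 := by
      nlinarith [mul_le_mul_of_nonneg_right hB hB0.le, mul_pos hN hB0, mul_pos hw₀ (mul_pos hN hB0)]
    nlinarith
  have h2 : A ^ 2 * |B - N| ≤ (A ^ 4 / r + r * (B - N) ^ 2) / 2 := by
    have : A ^ 4 / r + r * (B - N) ^ 2 - 2 * (A ^ 2 * |B - N|) =
        (A ^ 2 - r * |B - N|) ^ 2 / r := by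
      rw [← sq_abs (B - N)]; field_simp; ring
    have h3 : 0 ≤ (A ^ 2 - r * |B - N|) ^ 2 / r := by positivity
    linarith
  rw [e, abs_neg, abs_mul, abs_mul, abs_of_nonneg (sq_nonneg A),
    abs_of_pos (by positivity : 0 < (N + B) / (N * B ^ 2))]
  calc _ ≤ (A ^ 4 / r + r * (B - N) ^ 2) / 2 * ((1 / w₀ ^ 2) * (2 / N ^ 2)) :=
        mul_le_mul h2 h1 (by positivity) (by positivity)
    _ = _ := by field_simp

theorem abs_ratio_sub_le {N A B w₀ : ℝ} (hN : 0 < N) (hw₀ : 0 < w₀) (hB : w₀ * N ≤ B) :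
    |A / B - A / N| ≤ (1 / w₀) * ((A ^ 2 + (B - N) ^ 2) / N ^ 2) := by
  have hB0 : 0 < B := (mul_pos hw₀ hN).trans_le hB
  have e : A / B - A / N = -(A * (B - N) / (N * B)) := by field_simp; ring
  rw [e, abs_neg, abs_div, abs_mul, abs_of_pos (mul_pos hN hB0), one_div_mul_eq_div, div_div]
  refine div_le_div₀ (by positivity) ?_ (by positivity) ?_
  · rw [← sq_abs A, ← sq_abs (B - N)]
    nlinarith [sq_nonneg (|A| - |B - N|), sq_nonneg (|A| + |B - N|)]
  · nlinarith

variable {S : Type*} [Fintype S] {P : Matrix S S ℝ} {π w : S → ℝ}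

/-- Delta method: when the stationary mean of the weight is `1`, the asymptotic variance of the
weighted estimator is that of the additive functional of the centred function `w * (h - m)`,
expressed through a solution `u` of its Poisson equation. -/
theorem hasAsymptoticVariance_of_poisson [Nonempty S] (hP : ∀ x y, 0 ≤ P x y)
    (hP1 : ∀ x, ∑ y, P x y = 1) (hπ1 : ∑ x, π x = 1) (hπ0 : ∀ x, 0 ≤ π x)
    (hπ : ∀ y, ∑ x, π x * P x y = π y)
    (hharm : ∀ u : S → ℝ, P.mulVec u = u → ∀ x y, u x = u y)
    (hw : ∀ x, 0 < w x) (hπw : ∑ x, π x * w x = 1) {h u : S → ℝ} {m : ℝ}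
    (hu : ∀ x, w x * (h x - m) = u x - P.mulVec u x) :
    HasAsymptoticVariance P w h (∑ x, π x * stepVar P u x) := by
  intro μ hμ
  set c := ∑ x, π x * stepVar P u x
  obtain ⟨q, hq⟩ := exists_poisson_solution hπ1 hπ hharm w
  obtain ⟨C, hC, hA⟩ := exists_additive_moment_bounds hP hP1 hπ1 hπ hharm hμ hu
  obtain ⟨D, hD, hG⟩ := exists_additive_moment_bounds hP hP1 hπ1 hπ hharm hμ
    (φ := fun x => w x - 1) (u := q) fun x => by rw [hq x, hπw]; ring
  obtain ⟨hμ0, hμ1⟩ := hμ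
  obtain ⟨x₀, hx₀⟩ := Finite.exists_min w
  set w₀ := w x₀
  have hw₀ : 0 < w₀ := hw x₀
  have hw₁ : w₀ ≤ 1 := by
    rw [← hπw, ← one_mul w₀, ← hπ1, Finset.sum_mul]
    exact Finset.sum_le_sum fun x _ => mul_le_mul_of_nonneg_left (hx₀ x) (hπ0 x)
  set C₁ := (1 / w₀ ^ 2) * (C + D)
  set C₂ := C + (1 / w₀) * (C + D)
  have hC₁ : 0 ≤ C₁ := by positivity
  have hC₂ : 0 ≤ C₂ := by positivity
  have main : ∀ n : ℕ, |((n : ℝ) + 1) * pathVar μ P n (weightedEstimator w h n) - c| ≤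
      (C₁ + C + C₂ ^ 2) / √(n + 1) := fun n => by
    set N : ℝ := n + 1 with hN
    have hN1 : 1 ≤ N := by rw [hN]; linarith [(n.cast_nonneg : (0 : ℝ) ≤ n)]
    have hN0 : 0 < N := by linarith
    set r := √N
    have hr2 : r ^ 2 = N := Real.sq_sqrt hN0.le
    have hr1 : 1 ≤ r := Real.one_le_sqrt.2 hN1
    have hr0 : 0 < r := by linarith
    let A : (Fin (n + 1) → S) → ℝ := fun x => ∑ t, w (x t) * (h (x t) - m)
    let B : (Fin (n + 1) → S) → ℝ := fun x => ∑ t, w (x t)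
    have hB : ∀ x, w₀ * N ≤ B x := fun x => by
      have := Finset.card_nsmul_le_sum (Finset.univ : Finset (Fin (n + 1))) (fun t => w (x t)) w₀
        fun t _ => hx₀ _
      simp only [Finset.card_univ, Fintype.card_fin, nsmul_eq_mul, Nat.cast_add, Nat.cast_one] at this
      rw [hN, mul_comm]; exact this
    have hGe : ∀ x, ∑ t, (w (x t) - 1) = B x - N := fun x => by
      simp [B, hN, Finset.sum_sub_distrib]
    have hest : weightedEstimator w h n = fun x => m + A x / B x := by
      ext x
      have hB0 : B x ≠ 0 := ((mul_pos hw₀ hN0).trans_le (hB x)).ne'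
      change (∑ t, w (x t) * h (x t)) / B x = _
      have : A x = (∑ t, w (x t) * h (x t)) - m * B x := by
        simp only [A, B, mul_sub, Finset.sum_sub_distrib, ← Finset.sum_mul, mul_comm m]
      rw [this]; field_simp; ring
    obtain ⟨a1, a2, a4, ac⟩ := hA n
    obtain ⟨-, b2, -, -⟩ := hG n
    simp only [hGe] at b2
    rw [hest, pathVar_const_add hμ1 hP1]
    set E := pathExp μ P n
    -- second moment of the ratio
    have s1 : |N * E (fun x => (A x / B x) ^ 2) - E (fun x => A x ^ 2) / N| ≤ C₁ / r := by
      have := abs_pathExp_le hμ0 hP (n := n)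
        fun x => abs_ratio_sq_sub_le (A := A x) hN0 hw₀ hw₁ (hB x)
      rw [pathExp_sub, pathExp_const_mul, pathExp_const_mul] at this
      simp only [div_eq_inv_mul (_ + _) (N ^ 2), div_eq_inv_mul (A _ ^ 4),
        div_eq_inv_mul (A _ ^ 2)] at this
      rw [pathExp_const_mul, pathExp_const_mul, pathExp_add, pathExp_const_mul,
        pathExp_const_mul] at this
      rw [div_eq_inv_mul]
      refine this.trans ?_
      have t1 : r⁻¹ * E (fun x => A x ^ 4) ≤ r⁻¹ * (C * N ^ 2) :=
        mul_le_mul_of_nonneg_left a4 (by positivity)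
      have t2 : r * E (fun x => (B x - N) ^ 2) ≤ r * (D * N) :=
        mul_le_mul_of_nonneg_left b2 (by positivity)
      refine (mul_le_mul_of_nonneg_left (mul_le_mul_of_nonneg_left (add_le_add t1 t2)
        (by positivity)) (by positivity)).trans (le_of_eq ?_)
      simp only [C₁]
      rw [← hr2]; field_simp
    have s2 : |E (fun x => A x ^ 2) / N - c| ≤ C / r := by
      have : E (fun x => A x ^ 2) / N - c = (E (fun x => A x ^ 2) - N * c) / N := by
        field_simp
      rw [this, abs_div, abs_of_pos hN0, div_le_div_iff₀ hN0 hr0]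
      refine (mul_le_mul_of_nonneg_right ac hr0.le).trans (le_of_eq ?_)
      rw [mul_assoc, ← sq, hr2]
    -- the mean of the ratio is of order `1 / N`
    have s3 : |E (fun x => A x / B x)| ≤ C₂ / N := by
      have := abs_pathExp_le hμ0 hP (n := n)
        fun x => abs_ratio_sub_le (A := A x) hN0 hw₀ (hB x)
      simp only [div_eq_inv_mul (_ + _) (N ^ 2), div_eq_inv_mul (A _) N] at this
      rw [pathExp_sub, pathExp_const_mul, pathExp_const_mul, pathExp_const_mul,
        pathExp_add] at this
      have t1 : (1 / w₀) * ((N ^ 2)⁻¹ * (E (fun x => A x ^ 2) + E (fun x => (B x - N) ^ 2))) ≤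
          (1 / w₀) * ((N ^ 2)⁻¹ * (C * N + D * N)) :=
        mul_le_mul_of_nonneg_left (mul_le_mul_of_nonneg_left (add_le_add a2 b2)
          (by positivity)) (by positivity)
      have t2 : |N⁻¹ * E A| ≤ N⁻¹ * C := by
        rw [abs_mul, abs_of_pos (inv_pos.2 hN0)]
        exact mul_le_mul_of_nonneg_left a1 (by positivity)
      have t3 : C₂ / N = N⁻¹ * C + (1 / w₀) * ((N ^ 2)⁻¹ * (C * N + D * N)) := by
        simp only [C₂]; field_simp
      have t4 := abs_add_le (E (fun x => A x / B x) - N⁻¹ * E A) (N⁻¹ * E A)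
      rw [sub_add_cancel] at t4
      linarith
    have s4 : N * E (fun x => A x / B x) ^ 2 ≤ C₂ ^ 2 / r := by
      have := sq_le_sq' (abs_le.1 s3).1 (abs_le.1 s3).2
      calc _ ≤ N * (C₂ / N) ^ 2 := mul_le_mul_of_nonneg_left this hN0.le
        _ = C₂ ^ 2 / N := by field_simp
        _ ≤ C₂ ^ 2 / r := div_le_div_of_nonneg_left (by positivity) hr0 (by nlinarith)
    have s5 : 0 ≤ N * E (fun x => A x / B x) ^ 2 := by positivity
    have s6 : (C₁ + C + C₂ ^ 2) / r = C₁ / r + C / r + C₂ ^ 2 / r := by ring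
    rw [s6, mul_sub]
    obtain ⟨l1, u1⟩ := abs_le.1 s1
    obtain ⟨l2, u2⟩ := abs_le.1 s2
    exact abs_le.2 ⟨by linarith, by linarith [div_nonneg (sq_nonneg C₂) hr0.le]⟩
  refine tendsto_iff_norm_sub_tendsto_zero.2 (squeeze_zero (fun _ => norm_nonneg _) main ?_)
  refine Tendsto.div_atTop tendsto_const_nhds (Real.tendsto_sqrt_atTop.comp ?_)
  exact tendsto_atTop_add_const_right _ _ tendsto_natCast_atTop_atTop

end Ratio

/-! ### Reversible jump chains -/

section Reversible

variable {S : Type*} [Fintype S]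

/-- A finite irreducible chain with transition matrix `P`, reversible with respect to the
probability `f * Z`, together with the jump rates `Z` that turn it into a jump process reversible
with respect to the probability `f`. Irreducibility is stated in the form in which it is used:
a function that is constant along all possible transitions is constant. -/
structure IsReversibleJumpChain (f Z : S → ℝ) (P : Matrix S S ℝ) : Prop where
  f_pos : ∀ x, 0 < f x
  Z_pos : ∀ x, 0 < Z x
  sum_f : ∑ x, f x = 1
  sum_fZ : ∑ x, f x * Z x = 1
  nonneg : ∀ x y, 0 ≤ P x y
  row_sum : ∀ x, ∑ y, P x y = 1
  detailed_balance : ∀ x y, f x * Z x * P x y = f y * Z y * P y x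
  connected : ∀ u : S → ℝ, (∀ x y, 0 < P x y → u x = u y) → ∀ x y, u x = u y

namespace IsReversibleJumpChain

variable {f Z : S → ℝ} {P : Matrix S S ℝ} (hc : IsReversibleJumpChain f Z P)
include hc

theorem stationary (y : S) : ∑ x, f x * Z x * P x y = f y * Z y := by
  rw [Finset.sum_congr rfl fun x _ => hc.detailed_balance x y, ← Finset.mul_sum, hc.row_sum,
    mul_one]

/-- The Dirichlet form of the jump matrix. -/
theorem dirichlet_form (u : S → ℝ) :
    ∑ x, f x * u x * (Z x * (u x - P.mulVec u x)) =
      1 / 2 * ∑ x, ∑ y, f x * Z x * P x y * (u x - u y) ^ 2 := by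
  have e1 : ∑ x, ∑ y, f x * Z x * P x y * u x ^ 2 = ∑ x, f x * Z x * u x ^ 2 :=
    Finset.sum_congr rfl fun x _ => by
      rw [← Finset.sum_mul, ← Finset.mul_sum, hc.row_sum, mul_one]
  have e2 : ∑ x, ∑ y, f x * Z x * P x y * u y ^ 2 = ∑ x, f x * Z x * u x ^ 2 := by
    rw [Finset.sum_comm]
    exact Finset.sum_congr rfl fun y _ => by rw [← Finset.sum_mul, hc.stationary]
  have e3 : ∑ x, ∑ y, f x * Z x * P x y * (u x - u y) ^ 2 =
      ∑ x, ∑ y, f x * Z x * P x y * u x ^ 2 + ∑ x, ∑ y, f x * Z x * P x y * u y ^ 2 -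
        2 * ∑ x, ∑ y, f x * Z x * P x y * (u x * u y) := by
    simp only [Finset.mul_sum, ← Finset.sum_add_distrib, ← Finset.sum_sub_distrib]
    exact Finset.sum_congr rfl fun x _ => Finset.sum_congr rfl fun y _ => by ring
  have e4 : ∑ x, f x * u x * (Z x * (u x - P.mulVec u x)) =
      ∑ x, f x * Z x * u x ^ 2 - ∑ x, ∑ y, f x * Z x * P x y * (u x * u y) := by
    rw [← Finset.sum_sub_distrib]
    refine Finset.sum_congr rfl fun x _ => ?_
    have : ∑ y, f x * Z x * P x y * (u x * u y) = f x * Z x * u x * P.mulVec u x := by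
      simp only [Matrix.mulVec, dotProduct, Finset.mul_sum]
      exact Finset.sum_congr rfl fun y _ => by ring
    rw [this]; ring
  rw [e4, e3, e1, e2]; ring

theorem dirichlet_term_nonneg (u : S → ℝ) (x y : S) :
    0 ≤ f x * Z x * P x y * (u x - u y) ^ 2 :=
  mul_nonneg (mul_nonneg (mul_pos (hc.f_pos x) (hc.Z_pos x)).le (hc.nonneg x y)) (sq_nonneg _)

theorem eq_of_harmonic (u : S → ℝ) (hu : P.mulVec u = u) (x y : S) : u x = u y := by
  refine hc.connected u (fun x y hxy => ?_) x y
  have h := hc.dirichlet_form u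
  simp only [hu, sub_self, mul_zero, Finset.sum_const_zero] at h
  have h0 : ∑ x, ∑ y, f x * Z x * P x y * (u x - u y) ^ 2 = 0 := by linarith
  have h1 := (Finset.sum_eq_zero_iff_of_nonneg fun x _ => Finset.sum_nonneg fun y _ =>
    hc.dirichlet_term_nonneg u x y).1 h0 x (Finset.mem_univ x)
  have h2 := (Finset.sum_eq_zero_iff_of_nonneg fun y _ =>
    hc.dirichlet_term_nonneg u x y).1 h1 y (Finset.mem_univ y)
  have h3 : f x * Z x * P x y ≠ 0 :=
    (mul_pos (mul_pos (hc.f_pos x) (hc.Z_pos x)) hxy).ne'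
  have := (mul_eq_zero.1 h2).resolve_left h3
  linarith [pow_eq_zero_iff (two_ne_zero) |>.1 this]

/-- The stationary mean of the one-step conditional variance of `u` is
`π(u²) - π((P u)²) ≤ 2 π(u (u - P u))`. -/
theorem sum_stepVar_le (u : S → ℝ) :
    ∑ x, f x * Z x * stepVar P u x ≤ 2 * ∑ x, f x * u x * (Z x * (u x - P.mulVec u x)) := by
  have e : ∀ x, stepVar P u x = P.mulVec (fun y => u y ^ 2) x - P.mulVec u x ^ 2 := fun x => by
    have : ∀ y, P x y * (u y - P.mulVec u x) ^ 2 =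
        P x y * u y ^ 2 - 2 * P.mulVec u x * (P x y * u y) + P x y * P.mulVec u x ^ 2 :=
      fun y => by ring
    simp only [stepVar, this, Finset.sum_add_distrib, Finset.sum_sub_distrib, ← Finset.mul_sum,
      ← Finset.sum_mul, hc.row_sum]
    simp only [Matrix.mulVec, dotProduct]
    ring
  simp only [e, mul_sub (_ * _) _ (_ ^ 2), Finset.sum_sub_distrib]
  rw [sum_mul_mulVec (w := fun x => f x * Z x) hc.stationary, ← Finset.sum_sub_distrib,
    Finset.mul_sum]
  refine Finset.sum_le_sum fun x _ => ?_
  nlinarith [mul_nonneg (mul_pos (hc.f_pos x) (hc.Z_pos x)).le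
    (sq_nonneg (u x - P.mulVec u x))]

end IsReversibleJumpChain

end Reversible

/-! ### Spectral gap -/

section SpectralGap

variable {S : Type*} [Fintype S] [DecidableEq S]

/-- If every non-zero eigenvalue of `B` is at least `g ≥ 0`, then `g * B ≤ B ^ 2` as quadratic forms;
the kernel of `B` contributes nothing to either side. -/
theorem Matrix.IsHermitian.mul_dotProduct_mulVec_le {B : Matrix S S ℝ} (hB : B.IsHermitian)
    {g : ℝ} (hg : 0 ≤ g) (h : ∀ i, hB.eigenvalues i = 0 ∨ g ≤ hB.eigenvalues i) (v : S → ℝ) :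
    g * (v ⬝ᵥ B.mulVec v) ≤ B.mulVec v ⬝ᵥ B.mulVec v := by
  set b := hB.eigenvectorBasis
  have hcoef : ∀ i, (b i).ofLp ⬝ᵥ B.mulVec v = hB.eigenvalues i * ((b i).ofLp ⬝ᵥ v) := fun i => by
    have hBt : B.transpose = B := by simpa using hB.eq
    rw [Matrix.dotProduct_mulVec, ← Matrix.mulVec_transpose, hBt, hB.mulVec_eigenvectorBasis,
      smul_dotProduct, smul_eq_mul]
  have hdot : ∀ x y : S → ℝ, x ⬝ᵥ y = ∑ i, ((b i).ofLp ⬝ᵥ x) * ((b i).ofLp ⬝ᵥ y) := fun x y => by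
    have := b.sum_inner_mul_inner (WithLp.toLp 2 x) (WithLp.toLp 2 y)
    simp only [EuclideanSpace.inner_eq_star_dotProduct, star_trivial] at this
    rw [dotProduct_comm, ← this]
    exact Finset.sum_congr rfl fun i _ => by rw [dotProduct_comm y]
  rw [hdot v, hdot (B.mulVec v), Finset.mul_sum]
  refine Finset.sum_le_sum fun i _ => ?_
  rw [hcoef]
  have h2 : g * hB.eigenvalues i ≤ hB.eigenvalues i ^ 2 := by
    rcases h i with h | h
    · simp [h]
    · nlinarith
  nlinarith [mul_le_mul_of_nonneg_right h2 (sq_nonneg ((b i).ofLp ⬝ᵥ v))]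

theorem neg_jumpMatrix_mulVec {Z : S → ℝ} {P : Matrix S S ℝ} (hP1 : ∀ x, ∑ y, P x y = 1)
    (u : S → ℝ) (x : S) :
    (-jumpMatrix Z P).mulVec u x = Z x * (u x - P.mulVec u x) := by
  have hent : ∀ y, (-jumpMatrix Z P) x y = Z x * ((if x = y then 1 else 0) - P x y) := fun y => by
    rw [Matrix.neg_apply, jumpMatrix]
    split_ifs with hxy
    · subst hxy
      rw [neg_neg, ← Finset.mul_sum, Finset.sum_erase_eq_sub (Finset.mem_univ x), hP1]
    · ring
  simp only [Matrix.mulVec, dotProduct, hent, mul_assoc, sub_mul, ← Finset.mul_sum,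
    Finset.sum_sub_distrib]
  simp

namespace IsReversibleJumpChain

variable {f Z : S → ℝ} {P : Matrix S S ℝ} (hc : IsReversibleJumpChain f Z P)
include hc

theorem eigenvalue_nonneg {c : ℝ}
    (h : Module.End.HasEigenvalue (Matrix.toLin' (-jumpMatrix Z P)) c) : 0 ≤ c := by
  obtain ⟨u, hu⟩ := h.exists_hasEigenvector
  have hu1 : ∀ x, Z x * (u x - P.mulVec u x) = c * u x := fun x => by
    have := congrFun hu.apply_eq_smul x
    rwa [Matrix.toLin'_apply, neg_jumpMatrix_mulVec hc.row_sum] at this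
  obtain ⟨x₀, hx₀⟩ := Function.ne_iff.1 hu.2
  have hpos : 0 < ∑ x, f x * u x ^ 2 :=
    Finset.sum_pos' (fun x _ => mul_nonneg (hc.f_pos x).le (sq_nonneg _))
      ⟨x₀, Finset.mem_univ _, mul_pos (hc.f_pos x₀) (by simpa using sq_pos_of_ne_zero hx₀)⟩
  have h1 := hc.dirichlet_form u
  have h2 : ∑ x, f x * u x * (Z x * (u x - P.mulVec u x)) = c * ∑ x, f x * u x ^ 2 := by
    rw [Finset.mul_sum]
    exact Finset.sum_congr rfl fun x _ => by rw [hu1]; ring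
  have h3 : 0 ≤ ∑ x, ∑ y, f x * Z x * P x y * (u x - u y) ^ 2 :=
    Finset.sum_nonneg fun x _ => Finset.sum_nonneg fun y _ => hc.dirichlet_term_nonneg u x y
  refine nonneg_of_mul_nonneg_left ?_ hpos
  rw [← h2, h1]; positivity

/-- The matrix of `-Q` conjugated by `diag(√f)`, which is symmetric by detailed balance. -/
theorem symmetrized_isHermitian :
    (Matrix.of fun x y => √(f x) * (-jumpMatrix Z P) x y / √(f y)).IsHermitian := by
  refine Matrix.IsHermitian.ext fun x y => ?_
  simp only [Matrix.of_apply, star_trivial, Matrix.neg_apply, jumpMatrix]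
  have hx := Real.sqrt_pos.2 (hc.f_pos x)
  have hy := Real.sqrt_pos.2 (hc.f_pos y)
  rcases eq_or_ne x y with rfl | hxy
  · rfl
  · rw [if_neg hxy, if_neg hxy.symm, div_eq_div_iff hx.ne' hy.ne']
    have h := hc.detailed_balance x y
    have e1 := Real.sq_sqrt (hc.f_pos x).le
    have e2 := Real.sq_sqrt (hc.f_pos y).le
    rw [← e1, ← e2] at h
    linear_combination h

theorem symmetrized_mulVec (u : S → ℝ) (x : S) :
    (Matrix.of fun x y => √(f x) * (-jumpMatrix Z P) x y / √(f y)).mulVec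
      (fun y => √(f y) * u y) x = √(f x) * (-jumpMatrix Z P).mulVec u x := by
  simp only [Matrix.mulVec, dotProduct, Matrix.of_apply, Finset.mul_sum]
  refine Finset.sum_congr rfl fun y _ => ?_
  have hy := (Real.sqrt_pos.2 (hc.f_pos y)).ne'
  field_simp

theorem symmetrized_eigenvalue_mem (i : S) :
    hc.symmetrized_isHermitian.eigenvalues i = 0 ∨
      hc.symmetrized_isHermitian.eigenvalues i ∈ nonzeroEigenvaluesNeg (jumpMatrix Z P) := by
  set l := hc.symmetrized_isHermitian.eigenvalues i
  refine or_iff_not_imp_left.2 fun hl => ⟨hl, ?_⟩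
  set e := (hc.symmetrized_isHermitian.eigenvectorBasis i).ofLp with he
  have hpos : ∀ x, √(f x) ≠ 0 := fun x => (Real.sqrt_pos.2 (hc.f_pos x)).ne'
  have hee : e = fun y => √(f y) * (e y / √(f y)) := by
    ext y; rw [mul_div_cancel₀ _ (hpos y)]
  refine Module.End.hasEigenvalue_of_hasEigenvector (x := fun y => e y / √(f y))
    ⟨Module.End.mem_eigenspace_iff.2 ?_, ?_⟩
  · ext x
    have h1 := congrFun (hc.symmetrized_isHermitian.mulVec_eigenvectorBasis i) x
    rw [← he, hee, hc.symmetrized_mulVec, ← hee] at h1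
    rw [Matrix.toLin'_apply]
    simp only [Pi.smul_apply, smul_eq_mul] at h1 ⊢
    rw [← mul_div_assoc, eq_div_iff (hpos x), mul_comm, h1]
  · intro h0
    refine hc.symmetrized_isHermitian.eigenvectorBasis.orthonormal.ne_zero i ?_
    ext y
    have := congrFun h0 y
    simp only [Pi.zero_apply, div_eq_zero_iff, hpos y, or_false] at this
    exact this

/-- Existence of the gap. If zero were the only eigenvalue, the jump matrix would vanish by the
spectral theorem, no transition would be possible and the state space would be a point. -/
theorem exists_isLeast_gap [Nontrivial S] :
    ∃ g, IsLeast (nonzeroEigenvaluesNeg (jumpMatrix Z P)) g ∧ 0 < g := by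
  have hfin : (nonzeroEigenvaluesNeg (jumpMatrix Z P)).Finite :=
    (Module.End.finite_hasEigenvalue (Matrix.toLin' (-jumpMatrix Z P))).subset fun c h => h.2
  have hne : (nonzeroEigenvaluesNeg (jumpMatrix Z P)).Nonempty := by
    by_contra hemp
    rw [Set.not_nonempty_iff_eq_empty] at hemp
    have h0 : hc.symmetrized_isHermitian.eigenvalues = 0 := by
      ext i
      rcases hc.symmetrized_eigenvalue_mem i with h | h
      · exact h
      · rw [hemp] at h; exact h.elim
    rw [hc.symmetrized_isHermitian.eigenvalues_eq_zero_iff] at h0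
    obtain ⟨a, b, hab⟩ := exists_pair_ne S
    refine hab ?_
    have hharm : ∀ u : S → ℝ, P.mulVec u = u := fun u => by
      ext x
      have h1 := hc.symmetrized_mulVec u x
      rw [h0, Matrix.zero_mulVec, neg_jumpMatrix_mulVec hc.row_sum] at h1
      have h2 := (mul_eq_zero.1 h1.symm).resolve_left (Real.sqrt_pos.2 (hc.f_pos x)).ne'
      linarith [(mul_eq_zero.1 h2).resolve_left (hc.Z_pos x).ne']
    have := hc.eq_of_harmonic (fun x => if x = a then 1 else 0) (hharm _) a b
    by_contra hab
    simp [Ne.symm hab] at this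
  obtain ⟨g, hg, hmin⟩ := Set.exists_min_image _ id hfin hne
  exact ⟨g, ⟨hg, hmin⟩, lt_of_le_of_ne (hc.eigenvalue_nonneg hg.2) hg.1.symm⟩

/-- Spectral gap inequality `gap * ⟨u, -Q u⟩ ≤ ‖Q u‖²` in `L²(f)`. -/
theorem gap_mul_le {g : ℝ} (hg : IsLeast (nonzeroEigenvaluesNeg (jumpMatrix Z P)) g)
    (hg0 : 0 < g) (u : S → ℝ) :
    g * ∑ x, f x * u x * (Z x * (u x - P.mulVec u x)) ≤
      ∑ x, f x * (Z x * (u x - P.mulVec u x)) ^ 2 := by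
  have h := hc.symmetrized_isHermitian.mul_dotProduct_mulVec_le hg0.le
    (fun i => (hc.symmetrized_eigenvalue_mem i).imp_right fun h => hg.2 h)
    (fun x => √(f x) * u x)
  simp only [dotProduct, hc.symmetrized_mulVec, neg_jumpMatrix_mulVec hc.row_sum] at h
  have e := fun x => Real.mul_self_sqrt (hc.f_pos x).le
  convert h using 2
  · refine Finset.sum_congr rfl fun x _ => ?_
    linear_combination (-(u x * (Z x * (u x - P.mulVec u x)))) * e x
  · rename_i x _
    linear_combination (-(Z x * (u x - P.mulVec u x)) ^ 2) * e x

/-- The variance bound for a reversible jump chain. With `-Q u = h - E_f h`, the asymptotic variance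
is the stationary mean of `stepVar P u`, hence at most `2 ⟨u, -Q u⟩`. -/
theorem hasAsymptoticVariance_le [Nontrivial S] :
    ∃ gap : ℝ, IsLeast (nonzeroEigenvaluesNeg (jumpMatrix Z P)) gap ∧ 0 < gap ∧
      ∀ h : S → ℝ, ∃ v : ℝ, HasAsymptoticVariance P (fun x => (Z x)⁻¹) h v ∧
        v ≤ 2 * pmfVar f h / gap := by
  obtain ⟨g, hg, hg0⟩ := hc.exists_isLeast_gap
  refine ⟨g, hg, hg0, fun h => ?_⟩
  set m := pmfMean f h
  have hmul : ∀ x (c : ℝ), f x * Z x * ((Z x)⁻¹ * c) = f x * c := fun x c => by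
    have := (hc.Z_pos x).ne'
    field_simp
  have hcent : ∑ x, f x * (h x - m) = 0 := by
    simp only [mul_sub, Finset.sum_sub_distrib, ← Finset.sum_mul, hc.sum_f, one_mul]
    simp only [m, pmfMean, mul_comm, sub_self]
  obtain ⟨u, hu⟩ := exists_poisson_solution hc.sum_fZ hc.stationary hc.eq_of_harmonic
    (fun x => (Z x)⁻¹ * (h x - m))
  simp only [hmul, hcent, zero_add] at hu
  have hQu : ∀ x, Z x * (u x - P.mulVec u x) = h x - m := fun x => by
    rw [← hu, mul_inv_cancel_left₀ (hc.Z_pos x).ne']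
  refine ⟨_, hasAsymptoticVariance_of_poisson hc.nonneg hc.row_sum hc.sum_fZ
    (fun x => (mul_pos (hc.f_pos x) (hc.Z_pos x)).le) hc.stationary hc.eq_of_harmonic
    (fun x => inv_pos.2 (hc.Z_pos x)) ?_ hu, ?_⟩
  · rw [← hc.sum_f]
    exact Finset.sum_congr rfl fun x _ => mul_inv_cancel_right₀ (hc.Z_pos x).ne' _
  · have h1 := hc.sum_stepVar_le u
    have h2 := hc.gap_mul_le hg hg0 u
    have h3 : ∑ x, f x * (Z x * (u x - P.mulVec u x)) ^ 2 = pmfVar f h := by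
      have : ∀ x, f x * (h x - m) ^ 2 = h x ^ 2 * f x - 2 * m * (h x * f x) + f x * m ^ 2 :=
        fun x => by ring
      simp only [hQu, this, Finset.sum_add_distrib, Finset.sum_sub_distrib, ← Finset.mul_sum,
        ← Finset.sum_mul, hc.sum_f]
      change pmfMean f (fun x => h x ^ 2) - 2 * m * m + 1 * m ^ 2 = _
      simp only [pmfVar, m]
      ring
    rw [le_div_iff₀ hg0]
    nlinarith

end IsReversibleJumpChain

end SpectralGap

/-! ### The tempered Gibbs sampler -/

section Conditionals

variable {d : ℕ} {α : Fin d → Type*}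

theorem piSplitAt_symm_dropCoord (i : Fin d) (a : α i) (x : ∀ j, α j) :
    (Equiv.piSplitAt i α).symm (a, dropCoord i x) = Function.update x i a := by
  rw [Equiv.symm_apply_eq]
  ext j
  · simp [Equiv.piSplitAt]
  · simp [Equiv.piSplitAt, dropCoord, Function.update_of_ne j.2]

theorem dropCoord_update (i : Fin d) (a : α i) (x : ∀ j, α j) :
    dropCoord i (Function.update x i a) = dropCoord i x := by
  ext j
  exact Function.update_of_ne j.2 _ _

variable [∀ i, Fintype (α i)]

/-- Summation over the coordinate `i` and over all other coordinates separately. -/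
theorem sum_dropCoord (i : Fin d) (F : (∀ j : {j : Fin d // j ≠ i}, α j.1) → α i → ℝ) :
    ∑ x : ∀ j, α j, F (dropCoord i x) (x i) = ∑ z, ∑ a, F z a := by
  rw [← Fintype.sum_prod_type_right' (f := fun a z => F z a)]
  exact (Equiv.piSplitAt i α).sum_comp (fun p => F p.2 p.1)

variable {f : (∀ i, α i) → ℝ} {g : ∀ i : Fin d, (∀ j : {j : Fin d // j ≠ i}, α j.1) → α i → ℝ}

theorem marginalDrop_eq_sum (f : (∀ i, α i) → ℝ) (i : Fin d) (x : ∀ j, α j) :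
    marginalDrop f i x = ∑ a, f ((Equiv.piSplitAt i α).symm (a, dropCoord i x)) := by
  simp only [marginalDrop, piSplitAt_symm_dropCoord]

theorem marginalDrop_congr {i : Fin d} {x y : ∀ j, α j} (h : dropCoord i x = dropCoord i y) :
    marginalDrop f i x = marginalDrop f i y := by
  rw [marginalDrop_eq_sum, h, ← marginalDrop_eq_sum]

theorem le_marginalDrop (hf : ∀ x, 0 ≤ f x) (i : Fin d) (x : ∀ j, α j) :
    f x ≤ marginalDrop f i x := by
  have := Finset.single_le_sum (f := fun a => f (Function.update x i a)) (fun _ _ => hf _)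
    (Finset.mem_univ (x i))
  simpa [marginalDrop] using this

theorem mul_condRatio (hf : ∀ x, 0 ≤ f x) (hg : IsModifiedConditionals f g) (i : Fin d)
    (x : ∀ j, α j) :
    f x * condRatio f g i x = g i (dropCoord i x) (x i) * marginalDrop f i x := by
  have hle := le_marginalDrop hf i x
  rcases (hf x).eq_or_lt with h0 | h0
  · -- outside the support the right-hand side vanishes by absolute continuity
    rcases ((hf x).trans hle).eq_or_lt with hm | hm
    · rw [← h0, ← hm]; simp
    · rw [hg.absCont i x hm (by rw [fullCond, ← h0, zero_div]), ← h0]; simp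
  · have hm : marginalDrop f i x ≠ 0 := (h0.trans_le hle).ne'
    rw [condRatio, fullCond]
    field_simp

theorem condRatio_nonneg (hf : ∀ x, 0 ≤ f x) (hg : IsModifiedConditionals f g) (i : Fin d)
    (x : ∀ j, α j) : 0 ≤ condRatio f g i x :=
  div_nonneg ((hg.prob i _).1 _) (div_nonneg (hf x) ((hf x).trans (le_marginalDrop hf i x)))

theorem sum_mul_condRatio (hf : f ∈ stdSimplex ℝ (∀ i, α i)) (hg : IsModifiedConditionals f g)
    (i : Fin d) : ∑ x, f x * condRatio f g i x = 1 := by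
  simp only [mul_condRatio hf.1 hg, marginalDrop_eq_sum]
  rw [sum_dropCoord i (fun z a => g i z a * ∑ b, f ((Equiv.piSplitAt i α).symm (b, z)))]
  simp only [← Finset.sum_mul, (hg.prob i _).2, one_mul]
  rw [← sum_dropCoord i (fun z b => f ((Equiv.piSplitAt i α).symm (b, z))), ← hf.2]
  exact Finset.sum_congr rfl fun x _ => by rw [piSplitAt_symm_dropCoord, Function.update_eq_self]

theorem sum_mul_tgsZ (hd : 0 < d) (hf : f ∈ stdSimplex ℝ (∀ i, α i))
    (hg : IsModifiedConditionals f g) : ∑ x, f x * tgsZ f g x = 1 := by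
  have hd' : (d : ℝ) ≠ 0 := by exact_mod_cast hd.ne'
  have : ∀ x, f x * tgsZ f g x = 1 / (d : ℝ) * ∑ i, f x * condRatio f g i x := fun x => by
    rw [tgsZ, ← Finset.mul_sum]; ring
  simp only [this]
  rw [← Finset.mul_sum, Finset.sum_comm]
  simp [sum_mul_condRatio hf hg, hd']

theorem sum_condRatio_pos {x : ∀ j, α j} (hZ : 0 < tgsZ f g x) : 0 < ∑ i, condRatio f g i x :=
  pos_of_mul_pos_right hZ (by positivity)

theorem sum_selectProb {x : ∀ j, α j} (hZ : 0 < tgsZ f g x) : ∑ i, selectProb f g i x = 1 := by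
  simp only [selectProb, ← Finset.sum_div]
  exact div_self (sum_condRatio_pos hZ).ne'

theorem selectProb_nonneg (hf : ∀ x, 0 ≤ f x) (hg : IsModifiedConditionals f g) (i : Fin d)
    (x : ∀ j, α j) : 0 ≤ selectProb f g i x :=
  div_nonneg (condRatio_nonneg hf hg i x)
    (Finset.sum_nonneg fun j _ => condRatio_nonneg hf hg j x)

/-- The stationary flow out of `x` along coordinate `i` does not involve the normalisation. -/
theorem mul_tgsZ_mul_selectProb (hf : ∀ x, 0 ≤ f x) (hg : IsModifiedConditionals f g)
    {x : ∀ j, α j} (hZ : 0 < tgsZ f g x) (i : Fin d) :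
    f x * tgsZ f g x * selectProb f g i x =
      1 / d * (g i (dropCoord i x) (x i) * marginalDrop f i x) := by
  have h := (sum_condRatio_pos hZ).ne'
  rw [← mul_condRatio hf hg, tgsZ, selectProb]
  field_simp

/-- A function that vanishes outside the support has the same sum over the support. -/
theorem sum_supp {X : Type*} [Fintype X] {f F : X → ℝ} (h : ∀ x, ¬ 0 < f x → F x = 0) :
    ∑ x : Supp f, F x.1 = ∑ x, F x := by
  rw [← Finset.sum_filter_of_ne (p := fun x => 0 < f x) fun x _ hx => not_not.1 (mt (h x) hx)]
  exact (Finset.sum_subtype _ (by simp) F).symm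

theorem Matrix.IsIrreducible.eq_of_eq_of_pos {S : Type*} {P : Matrix S S ℝ}
    (hP : P.IsIrreducible) {u : S → ℝ} (hu : ∀ x y, 0 < P x y → u x = u y) (x y : S) :
    u x = u y := by
  let := P.toQuiver
  obtain ⟨p, -⟩ := hP.connected x y
  induction p with
  | nil => rfl
  | cons _ e ih => exact ih.trans (hu _ _ e.down)

variable [∀ i, DecidableEq (α i)]

theorem isReversibleJumpChain_tgsKernel (hf : f ∈ stdSimplex ℝ (∀ i, α i))
    (hg : IsModifiedConditionals f g) (hnt : Nontrivial (Supp f))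
    (hZ : ∀ x : Supp f, 0 < tgsZ f g x.1) (hirr : (tgsKernel f g).IsIrreducible) :
    IsReversibleJumpChain (fun x : Supp f => f x.1) (fun x : Supp f => tgsZ f g x.1)
      (tgsKernel f g) where
  f_pos x := x.2
  Z_pos := hZ
  sum_f := by
    rw [← hf.2]
    exact sum_supp (F := f) fun x hx => le_antisymm (not_lt.1 hx) (hf.1 x)
  sum_fZ := by
    -- for `d = 0` the junk value `1 / 0 = 0` makes `Z` vanish
    have hd : 0 < d := by
      rcases Nat.eq_zero_or_pos d with rfl | hd
      · exact absurd (hZ hnt.exists_pair_ne.choose) (by simp [tgsZ])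
      · exact hd
    rw [← sum_mul_tgsZ hd hf hg]
    exact sum_supp (F := fun x => f x * tgsZ f g x) fun x hx => by
      rw [le_antisymm (not_lt.1 hx) (hf.1 x), zero_mul]
  nonneg x y := Finset.sum_nonneg fun i _ => mul_nonneg (selectProb_nonneg hf.1 hg i _) (by
    split_ifs
    · exact (hg.prob i _).1 _
    · exact le_rfl)
  row_sum x := by
    simp only [tgsKernel]
    rw [Finset.sum_comm, ← sum_selectProb (hZ x)]
    refine Finset.sum_congr rfl fun i _ => ?_
    rw [← Finset.mul_sum]
    have hrow : ∑ y : Supp f, (if dropCoord i y.1 = dropCoord i x.1 then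
        g i (dropCoord i x.1) (y.1 i) else 0) = 1 := by
      rw [sum_supp (F := fun y => if dropCoord i y = dropCoord i x.1 then
        g i (dropCoord i x.1) (y i) else 0) fun y hy => ?_]
      · rw [sum_dropCoord i (fun z a => if z = dropCoord i x.1 then
          g i (dropCoord i x.1) a else 0)]
        rw [Finset.sum_eq_single (dropCoord i x.1) (fun z _ hz => by simp [hz]) (by simp)]
        simpa using (hg.prob i _).2
      · split_ifs with h
        · have hy0 : f y = 0 := le_antisymm (not_lt.1 hy) (hf.1 y)
          rw [← h]
          refine hg.absCont i y ?_ (by rw [fullCond, hy0, zero_div])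
          rw [marginalDrop_congr h]
          exact x.2.trans_le (le_marginalDrop hf.1 i x.1)
        · rfl
    rw [hrow, mul_one]
  detailed_balance x y := by
    simp only [tgsKernel, Finset.mul_sum, ← mul_assoc]
    refine Finset.sum_congr rfl fun i _ => ?_
    rw [mul_tgsZ_mul_selectProb hf.1 hg (hZ x), mul_tgsZ_mul_selectProb hf.1 hg (hZ y)]
    by_cases h : dropCoord i y.1 = dropCoord i x.1
    · rw [if_pos h, if_pos h.symm, h, marginalDrop_congr h]; ring
    · rw [if_neg h, if_neg (Ne.symm h), mul_zero, mul_zero]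
  connected _ hu := hirr.eq_of_eq_of_pos hu

end Conditionals

/-! ### The flip version -/

section Flip

variable {p : ℕ} {f : (Fin p → Bool) → ℝ}

theorem isModifiedConditionals_unifCond (hf : ∀ x, 0 < f x) :
    IsModifiedConditionals (α := fun _ => Bool) f unifCond where
  prob _ _ := ⟨fun _ => by norm_num [unifCond], by norm_num [unifCond]⟩
  absCont _ x hm h := absurd h (div_pos (hf x) hm).ne'

/-- A function on the hypercube that is invariant under every flip is constant: the coordinates
where `x` and `y` differ can be flipped one after another. -/
theorem eq_of_flip_invariant {u : (Fin p → Bool) → ℝ}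
    (hu : ∀ x i, u x = u (Function.update x i (!x i))) (x y : Fin p → Bool) : u x = u y := by
  have hset : ∀ (x : Fin p → Bool) i a, u (Function.update x i a) = u x := fun x i a => by
    rcases Bool.eq_or_eq_not a (x i) with h | h
    · rw [h, Function.update_eq_self]
    · rw [h]; exact (hu x i).symm
  have hs : ∀ s : Finset (Fin p), u (s.piecewise y x) = u x := fun s => by
    induction s using Finset.induction_on with
    | empty => simp
    | insert i s _ ih => rw [Finset.piecewise_insert, hset, ih]
  simpa using (hs Finset.univ).symm

theorem eq_update_not_comm {x y : Fin p → Bool} {i : Fin p} :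
    y = Function.update x i (!x i) ↔ x = Function.update y i (!y i) := by
  constructor <;> rintro rfl <;> simp

theorem isReversibleJumpChain_flipKernel (hp : 0 < p) (hf : f ∈ stdSimplex ℝ (Fin p → Bool))
    (hpos : ∀ x, 0 < f x) :
    IsReversibleJumpChain f (tgsZ f unifCond) (flipKernel f) := by
  have hg := isModifiedConditionals_unifCond hpos
  have hr : ∀ i x, 0 < condRatio f unifCond i x := fun i x =>
    div_pos (by norm_num [unifCond]) (div_pos (hpos x) ((hpos x).trans_le
      (le_marginalDrop hf.1 i x)))
  have hne : (Finset.univ : Finset (Fin p)).Nonempty := ⟨⟨0, hp⟩, Finset.mem_univ _⟩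
  have hZ : ∀ x, 0 < tgsZ f unifCond x := fun x =>
    mul_pos (by positivity) (Finset.sum_pos (fun i _ => hr i x) hne)
  have hnn : ∀ x y i, 0 ≤ selectProb f unifCond i x *
      (if y = Function.update x i (!x i) then 1 else 0) := fun x y i =>
    mul_nonneg (selectProb_nonneg hf.1 hg i _) (by split_ifs <;> norm_num)
  refine ⟨hpos, hZ, hf.2, sum_mul_tgsZ hp hf hg, fun x y => Finset.sum_nonneg fun i _ => hnn x y i,
    fun x => ?_, fun x y => ?_, fun u hu => eq_of_flip_invariant fun x i => hu _ _ ?_⟩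
  · simp only [flipKernel]
    rw [Finset.sum_comm]
    exact (Finset.sum_congr rfl fun i _ => by simp).trans (sum_selectProb (hZ x))
  · simp only [flipKernel, Finset.mul_sum, ← mul_assoc]
    refine Finset.sum_congr rfl fun i _ => ?_
    rw [mul_tgsZ_mul_selectProb hf.1 hg (hZ x), mul_tgsZ_mul_selectProb hf.1 hg (hZ y)]
    by_cases h : y = Function.update x i (!x i)
    · have hm : marginalDrop f i x = marginalDrop f i y :=
        marginalDrop_congr (by rw [h, dropCoord_update])
      rw [if_pos h, if_pos (eq_update_not_comm.1 h), hm]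
      rfl
    · rw [if_neg h, if_neg (mt eq_update_not_comm.2 h), mul_zero, mul_zero]
  · refine Finset.sum_pos' (fun j _ => hnn _ _ j) ⟨i, Finset.mem_univ _, ?_⟩
    rw [if_pos rfl, mul_one]
    exact div_pos (hr i x) (Finset.sum_pos (fun j _ => hr j x) hne)

end Flip

end

theorem lemma2 :
    -- the tempered Gibbs sampler on a finite product space
    (∀ (d : ℕ) (α : Fin d → Type*) [∀ i, Fintype (α i)] [∀ i, DecidableEq (α i)]
      (f : (∀ i, α i) → ℝ)
      (g : ∀ i : Fin d, (∀ j : {j : Fin d // j ≠ i}, α j.1) → α i → ℝ),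
      f ∈ stdSimplex ℝ (∀ i, α i) →
      IsModifiedConditionals f g →
      Nontrivial (Supp f) →
      (∀ x : Supp f, 0 < tgsZ f g x.1) →
      (tgsKernel f g).IsIrreducible →
      ∃ gap : ℝ,
        IsLeast (nonzeroEigenvaluesNeg
          (jumpMatrix (fun x : Supp f => tgsZ f g x.1) (tgsKernel f g))) gap ∧
        0 < gap ∧
        ∀ h : (∀ i, α i) → ℝ, ∃ v : ℝ,
          HasAsymptoticVariance (tgsKernel f g) (fun x : Supp f => (tgsZ f g x.1)⁻¹)
            (fun x : Supp f => h x.1) v ∧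
          v ≤ 2 * pmfVar f h / gap) ∧
    -- the flip version on binary vectors
    (∀ (p : ℕ) (f : (Fin p → Bool) → ℝ),
      0 < p →
      f ∈ stdSimplex ℝ (Fin p → Bool) →
      (∀ x, 0 < f x) →
      ∃ gap : ℝ,
        IsLeast (nonzeroEigenvaluesNeg (jumpMatrix (tgsZ f unifCond) (flipKernel f))) gap ∧
        0 < gap ∧
        ∀ h : (Fin p → Bool) → ℝ, ∃ v : ℝ,
          HasAsymptoticVariance (flipKernel f) (fun x => (tgsZ f unifCond x)⁻¹) h v ∧
          v ≤ 2 * pmfVar f h / gap) := by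
  constructor
  · intro d α _ _ f g hf hg hnt hZ hirr
    obtain ⟨gap, hgap, hpos, H⟩ :=
      (isReversibleJumpChain_tgsKernel hf hg hnt hZ hirr).hasAsymptoticVariance_le
    refine ⟨gap, hgap, hpos, fun h => ?_⟩
    obtain ⟨v, hv, hle⟩ := H fun x => h x.1
    refine ⟨v, hv, hle.trans_eq ?_⟩
    have hmean : ∀ k : (∀ i, α i) → ℝ,
        pmfMean (fun x : Supp f => f x.1) (fun x => k x.1) = pmfMean f k := fun k =>
      sum_supp (F := fun x => k x * f x) fun x hx => by
        rw [le_antisymm (not_lt.1 hx) (hf.1 x), mul_zero]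
    rw [pmfVar, pmfVar, hmean, hmean fun x => h x ^ 2]
  · intro p f hp hf hpos
    have : Nonempty (Fin p) := ⟨⟨0, hp⟩⟩
    exact (isReversibleJumpChain_flipKernel hp hf hpos).hasAsymptoticVariance_le
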